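/- Let $(X,\mathcal B,\mu)$ be a probability space whose measure $\mu$ is separable (some countable family of measurable sets is dense in $\mathcal B$ for the distance $\mu(B\,\triangle\,C)$; equivalently $L^2(\mu)$ is separable), as is the case for a Borel probability measure on a compact metric space. Let $T:X\to X$ be measurable and $\mu$-preserving, and let $U_Tf=f\circ T$ on $L^2(\mu)$ (with real or complex scalars). A subsequence of $\mathbb N$ is a strictly increasing sequence $A=\{a_0<a_1<\cdots\}\subset\mathbb N$; a subsequence of $A$ is a sequence $S=\{a_{\varphi(0)}<a_{\varphi(1)}<\cdots\}$ with $\varphi:\mathbb N\to\mathbb N$ strictly increasing. The system $(X,\mathcal B,\mu,T)$ is called *rigid* if there is a strictly increasing sequence $(t_k)$ in $\mathbb N$ such that $U_T^{t_k}f\to f$ in $L^2(\mu)$ for every $f\in L^2(\mu)$. For $S=\{s_0<s_1<\cdots\}\subset\mathbb N$ the sequence entropy is $$h_\mu^S(T)=\sup_{\xi}\ \limsup_{n\to\infty}\frac1n H_\mu\Big(\bigvee_{i=0}^{n-1}T^{-s_i}\xi\Big),\qquad H_\mu(\eta)=-\sum_{C\in\eta}\mu(C)\log\mu(C)\quad(0\log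 0=0),$$ where the supremum is over all finite measurable partitions $\xi$ of $X$. **Theorem.** The following are equivalent: 1. $(X,\mathcal B,\mu,T)$ is rigid; 2. there is a subsequence $A$ of $\mathbb N$ such that $h_\mu^S(T)=0$ for every subsequence $S$ of $A$; 3. there is a subsequence $A$ of $\mathbb N$ such that $\{U_T^nf:n\in A\}$ is pre-compact (has compact closure) in $L^2(\mu)$ for every $f\in L^2(\mu)$. Moreover, for each individual subsequence $A$ of $\mathbb N$, one has $h_\mu^S(T)=0$ for every subsequence $S$ of $A$ if and only if $\{U_T^nf:n\in A\}$ is pre-compact in $L^2(\mu)$ for every $f\in L^2(\mu)$. -/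

import Mathlib

open MeasureTheory Filter Topology
open scoped ENNReal

noncomputable section

namespace SeqEntropy

variable {X : Type*} [MeasurableSpace X]

/-- A measurable partition of `X` with cells labelled by `ι` (finite when `ι` is). Some cells may
be empty; an empty cell contributes `0` to every entropy below. -/
structure MeasPartition (X : Type*) [MeasurableSpace X] (ι : Type*) where
  cell : ι → Set X
  measurableSet_cell : ∀ i, MeasurableSet (cell i)
  disjoint_cell : Pairwise (fun i j => Disjoint (cell i) (cell j))
  iUnion_cell : ⋃ i, cell i = Set.univ

/-- The pulled back partition `T⁻¹ ξ = {T⁻¹ A : A ∈ ξ}`. -/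
def MeasPartition.pullback {ι : Type*} (ξ : MeasPartition X ι) (T : X → X)
    (hT : Measurable T) : MeasPartition X ι where
  cell i := T ⁻¹' ξ.cell i
  measurableSet_cell i := hT (ξ.measurableSet_cell i)
  disjoint_cell _ _ hij := (ξ.disjoint_cell hij).preimage T
  iUnion_cell := by rw [← Set.preimage_iUnion, ξ.iUnion_cell, Set.preimage_univ]

/-- The common refinement `ξ 0 ∨ ⋯ ∨ ξ (n - 1)`, whose cells are the intersections
`A₀ ∩ ⋯ ∩ Aₙ₋₁` with `Aᵢ` a cell of `ξ i`. -/
def MeasPartition.join {ι : Type*} {n : ℕ} (ξ : Fin n → MeasPartition X ι) :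
    MeasPartition X (Fin n → ι) where
  cell a := ⋂ i, (ξ i).cell (a i)
  measurableSet_cell a := MeasurableSet.iInter fun i => (ξ i).measurableSet_cell (a i)
  disjoint_cell a b hab := by
    obtain ⟨i, hi⟩ := Function.ne_iff.mp hab
    exact ((ξ i).disjoint_cell hi).mono (Set.iInter_subset _ i) (Set.iInter_subset _ i)
  iUnion_cell := by
    refine Set.eq_univ_of_forall fun x => ?_
    have h : ∀ i, ∃ j, x ∈ (ξ i).cell j := fun i => by
      have hx : x ∈ ⋃ j, (ξ i).cell j := by rw [(ξ i).iUnion_cell]; exact Set.mem_univ x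
      exact Set.mem_iUnion.mp hx
    choose a ha using h
    exact Set.mem_iUnion.mpr ⟨a, Set.mem_iInter.mpr ha⟩

/-- The Shannon entropy `H_μ(ξ) = - ∑ μ(A) log μ(A)` over the cells `A` of `ξ`. -/
def partitionEntropy (μ : Measure X) {ι : Type*} [Fintype ι] (ξ : MeasPartition X ι) : ℝ :=
  - ∑ i, μ.real (ξ.cell i) * Real.log (μ.real (ξ.cell i))

/-- `h_μ^S(T, ξ) = limsup (1/n) H_μ(⋁ T^{-s} ξ)`, the join being over the first `n` terms
`s = S 0, …, S (n - 1)` of the sequence `S`. -/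
def seqEntropyPartition (μ : Measure X) {T : X → X} (hT : Measurable T) (S : ℕ → ℕ)
    {ι : Type*} [Fintype ι] (ξ : MeasPartition X ι) : EReal :=
  limsup (fun n : ℕ => (((1 / (n : ℝ)) * partitionEntropy μ
    (MeasPartition.join fun i : Fin n => ξ.pullback (T^[S i]) (hT.iterate (S i))) : ℝ) : EReal))
    atTop

/-- `h_μ^S(T)`, the supremum of `h_μ^S(T, ξ)` over all finite measurable partitions `ξ`. -/
def seqEntropy (μ : Measure X) {T : X → X} (hT : Measurable T) (S : ℕ → ℕ) : EReal :=
  ⨆ (k : ℕ) (ξ : MeasPartition X (Fin k)), seqEntropyPartition μ hT S ξ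

/-- The Koopman operator `U_T f = f ∘ T` on `L²(μ)`. -/
def koopman (𝕜 : Type*) [RCLike 𝕜] {μ : Measure X} {T : X → X} (hT : MeasurePreserving T μ μ) :
    Lp 𝕜 2 μ →ₗᵢ[𝕜] Lp 𝕜 2 μ :=
  Lp.compMeasurePreservingₗᵢ 𝕜 T hT

/-- Rigidity: `U_T^{t_k} f → f` in `L²(μ)` for all `f`, along one sequence `t_0 < t_1 < ⋯`
in `ℕ`. -/
def IsRigid (𝕜 : Type*) [RCLike 𝕜] {μ : Measure X} {T : X → X}
    (hT : MeasurePreserving T μ μ) : Prop :=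
  ∃ t : ℕ → ℕ, StrictMono t ∧
    ∀ f : Lp 𝕜 2 μ, Tendsto (fun k => (koopman 𝕜 hT)^[t k] f) atTop (𝓝 f)

/-- `h_μ^S(T) = 0` for every subsequence `S = A ∘ φ` of the sequence `A`. -/
def ZeroEntropyAlong {μ : Measure X} {T : X → X} (hT : MeasurePreserving T μ μ)
    (A : ℕ → ℕ) : Prop :=
  ∀ φ : ℕ → ℕ, StrictMono φ → seqEntropy μ hT.measurable (A ∘ φ) = 0

/-- `{U_T^n f : n ∈ A}` is pre-compact (has compact closure) in `L²(μ)` for every `f`. -/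
def PrecompactAlong (𝕜 : Type*) [RCLike 𝕜] {μ : Measure X} {T : X → X}
    (hT : MeasurePreserving T μ μ) (A : ℕ → ℕ) : Prop :=
  ∀ f : Lp 𝕜 2 μ, IsCompact (closure ((fun n : ℕ => (koopman 𝕜 hT)^[n] f) '' Set.range A))

end SeqEntropy

end

/-!
Give the measurable sets the pseudometric `μ (B ∆ D)`. For a sequence `A`, both zero entropy
along all subsequences of `A` and precompactness along `A` in `L²` say that `{T^{-A n} B}` is
totally bounded for every measurable `B`. For precompactness this is because `B ↦ 1_B` is
uniformly inducing, its image spans a dense subspace and the Koopman iterates are isometries. For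
entropy: if finitely many pullbacks of a partition approximate all the others, each further one
adds little conditional entropy, so the join of the first `n` has entropy at most `C + n δ`;
otherwise one greedily selects a subsequence each term of which stays a definite distance away
from the algebra generated by its predecessors, hence adds at least `ε` to the entropy.

For rigidity, two nearby terms `U^{A n} f ≈ U^{A m} f` of a totally bounded orbit give
`U^{A n - A m} f ≈ f`, and a diagonal argument along a dense sequence makes the return times
independent of `f`.
-/

namespace SeqEntropy

open Real Set TopologicalSpace
open scoped symmDiff

noncomputable section

section NegMulLog

lemma negMulLog_add_add_min_le {x y : ℝ} (hx : 0 ≤ x) (hy : 0 ≤ y) :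
    negMulLog (x + y) + min x y ≤ negMulLog x + negMulLog y := by
  rcases hx.eq_or_lt with rfl | hx
  · simp [hy]
  rcases hy.eq_or_lt with rfl | hy
  · simp [hx.le]
  have hs : 0 < x + y := add_pos hx hy
  have hlog : ∀ {a b : ℝ}, 0 < a → 0 < b → b / (a + b) ≤ log (a + b) - log a := by
    intro a b ha hb
    have h := one_sub_inv_le_log_of_pos (div_pos (add_pos ha hb) ha)
    rwa [log_div (add_pos ha hb).ne' ha.ne', inv_div, one_sub_div (add_pos ha hb).ne',
      add_sub_cancel_left] at h
  have hmin : min x y ≤ x * (y / (x + y)) + y * (x / (y + x)) := by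
    have h : x * (y / (x + y)) + y * (x / (y + x)) = 2 * (min x y * max x y) / (x + y) := by
      rw [min_mul_max, add_comm y x]
      ring
    rw [h, le_div_iff₀ hs]
    nlinarith [min_add_max x y, min_le_max (a := x) (b := y), lt_min hx hy]
  calc negMulLog (x + y) + min x y
      ≤ negMulLog (x + y) + (x * (y / (x + y)) + y * (x / (y + x))) := by
        gcongr
    _ ≤ negMulLog (x + y) +
          (x * (log (x + y) - log x) + y * (log (y + x) - log y)) := by
        gcongr
        exacts [hlog hx hy, hlog hy hx]
    _ = negMulLog x + negMulLog y := by
        simp only [negMulLog, add_comm y x]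
        ring

lemma negMulLog_add_le {x y : ℝ} (hx : 0 ≤ x) (hy : 0 ≤ y) :
    negMulLog (x + y) ≤ negMulLog x + negMulLog y :=
  (le_add_of_nonneg_right (le_min hx hy)).trans (negMulLog_add_add_min_le hx hy)

lemma negMulLog_sum_le {ι : Type*} (s : Finset ι) {p : ι → ℝ} (hp : ∀ i ∈ s, 0 ≤ p i) :
    negMulLog (∑ i ∈ s, p i) ≤ ∑ i ∈ s, negMulLog (p i) :=
  Finset.le_sum_of_subadditive_on_pred negMulLog (0 ≤ ·) negMulLog_zero.le
    (fun _ _ => negMulLog_add_le) (fun _ _ => add_nonneg) p hp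

lemma mul_log_sub_log_le_sub {p b : ℝ} (hp : 0 < p) (hb : 0 < b) :
    p * (log b - log p) ≤ b - p :=
  calc p * (log b - log p) = p * log (b / p) := by rw [log_div hb.ne' hp.ne']
    _ ≤ p * (b / p - 1) := by
        gcongr
        exact log_le_sub_one_of_pos (div_pos hb hp)
    _ = b - p := by field_simp

lemma sum_negMulLog_add_negMulLog_sum_le {ι κ : Type*} [Fintype ι] [Fintype κ] {q : ι → κ → ℝ}
    (hq : ∀ a c, 0 ≤ q a c) :
    (∑ a, ∑ c, negMulLog (q a c)) + negMulLog (∑ a, ∑ c, q a c) ≤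
      (∑ a, negMulLog (∑ c, q a c)) + ∑ c, negMulLog (∑ a, q a c) := by
  let s := ∑ a, ∑ c, q a c
  let r : ι → ℝ := fun a => ∑ c, q a c
  let k : κ → ℝ := fun c => ∑ a, q a c
  have hr : ∀ a, 0 ≤ r a := fun a => Finset.sum_nonneg fun c _ => hq a c
  have hks : ∑ c, k c = s := Finset.sum_comm
  -- Gibbs' inequality between `q` and the product of its marginals
  have gibbs : ∀ a c,
      q a c * (log (r a) + log (k c) - log s - log (q a c)) ≤ r a * k c / s - q a c := by
    intro a c
    have hra : q a c ≤ r a := Finset.single_le_sum (fun c _ => hq a c) (Finset.mem_univ c)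
    have hkc : q a c ≤ k c :=
      Finset.single_le_sum (f := fun a => q a c) (fun a _ => hq a c) (Finset.mem_univ a)
    have hrs : r a ≤ s := Finset.single_le_sum (fun a _ => hr a) (Finset.mem_univ a)
    rcases (hq a c).eq_or_lt with h0 | hpos
    · rw [← h0, zero_mul, sub_zero]
      exact div_nonneg (mul_nonneg (hr a) (h0.trans_le hkc)) ((hr a).trans hrs)
    have hr0 := hpos.trans_le hra
    have hk0 := hpos.trans_le hkc
    have hs0 := hr0.trans_le hrs
    have h := mul_log_sub_log_le_sub hpos (div_pos (mul_pos hr0 hk0) hs0)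
    rwa [log_div (by positivity) hs0.ne', log_mul hr0.ne' hk0.ne'] at h
  have hmass : ∑ a, ∑ c, (r a * k c / s - q a c) = 0 := by
    simp_rw [Finset.sum_sub_distrib, ← Finset.sum_div, ← Finset.mul_sum, hks, ← Finset.sum_mul]
    exact sub_eq_zero.2 (mul_self_div_self s)
  have hsum := (Finset.sum_le_sum fun a (_ : a ∈ Finset.univ) =>
    Finset.sum_le_sum fun c (_ : c ∈ Finset.univ) => gibbs a c).trans_eq hmass
  have hcol : ∑ a, ∑ c, q a c * log (k c) = ∑ c, k c * log (k c) := by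
    rw [Finset.sum_comm]
    simp_rw [← Finset.sum_mul, k]
  simp only [mul_sub, mul_add, Finset.sum_sub_distrib, Finset.sum_add_distrib, hcol,
    ← Finset.sum_mul] at hsum
  simp only [negMulLog, neg_mul, Finset.sum_neg_distrib]
  linarith

end NegMulLog

section Entropy

variable {X ι κ ν : Type*} [MeasurableSpace X] {μ : Measure X} [Fintype ι] [Fintype κ] [Fintype ν]

/-- The Shannon entropy of a finite-valued function `f`, that is, of the partition of `X` into the
fibres of `f`. Partitions are handled through such labellings because joins become pairings. -/
def entropy (μ : Measure X) (f : X → ι) : ℝ :=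
  ∑ i, negMulLog (μ.real (f ⁻¹' {i}))

/-- The conditional entropy `H(f | g) = H(g, f) - H(g)` of two finite-valued functions. -/
def condEntropy (μ : Measure X) (f : X → ι) (g : X → κ) : ℝ :=
  entropy μ (fun x => (g x, f x)) - entropy μ g

lemma entropy_prodMk (f : X → ι) (g : X → κ) :
    entropy μ (fun x => (f x, g x)) = ∑ i, ∑ j, negMulLog (μ.real (f ⁻¹' {i} ∩ g ⁻¹' {j})) := by
  simp only [entropy, Fintype.sum_prod_type, ← singleton_prod_singleton, ← mk_preimage_prod]

lemma entropy_nonneg [IsProbabilityMeasure μ] (f : X → ι) : 0 ≤ entropy μ f :=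
  Finset.sum_nonneg fun _ _ => negMulLog_nonneg measureReal_nonneg measureReal_le_one

variable [IsFiniteMeasure μ] [MeasurableSpace ι] [MeasurableSingletonClass ι]
  [MeasurableSpace κ] [MeasurableSingletonClass κ] [MeasurableSpace ν] [MeasurableSingletonClass ν]

lemma measureReal_comp_preimage_singleton {κ : Type*} [DecidableEq κ] {f : X → ι}
    (hf : Measurable f) (k : ι → κ) (j : κ) :
    μ.real (k ∘ f ⁻¹' {j}) = ∑ i with k i = j, μ.real (f ⁻¹' {i}) := by
  rw [sum_measureReal_preimage_singleton _ fun i _ => hf (measurableSet_singleton i)]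
  congr 1
  ext x
  simp

lemma sum_measureReal_inter_preimage_singleton {g : X → κ} (hg : Measurable g) (s : Set X) :
    ∑ j, μ.real (s ∩ g ⁻¹' {j}) = μ.real s := by
  have h := sum_measureReal_preimage_singleton (μ := μ.restrict s) Finset.univ (f := g)
    fun j _ => hg (measurableSet_singleton j)
  simpa only [measureReal_restrict_apply (hg (measurableSet_singleton _)), Finset.coe_univ,
    preimage_univ, measureReal_restrict_apply MeasurableSet.univ, univ_inter, inter_comm _ s,
    inter_univ] using h

lemma entropy_comp_le {κ : Type*} [Fintype κ] {f : X → ι} (hf : Measurable f) (k : ι → κ) :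
    entropy μ (k ∘ f) ≤ entropy μ f := by
  classical
  simp only [entropy, measureReal_comp_preimage_singleton hf,
    ← Finset.sum_fiberwise Finset.univ k fun i => negMulLog (μ.real (f ⁻¹' {i}))]
  exact Finset.sum_le_sum fun j _ => negMulLog_sum_le _ fun _ _ => measureReal_nonneg

lemma condEntropy_prodMk_le {f : X → ι} {h : X → ν} (hf : Measurable f) (hh : Measurable h)
    {κ : Type*} [Fintype κ] (g : X → κ) :
    condEntropy μ (fun x => (f x, h x)) g ≤ condEntropy μ f g + condEntropy μ h g := by
  have htriple : entropy μ (fun x => (g x, f x, h x)) =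
      ∑ b, ∑ a, ∑ c, negMulLog (μ.real (g ⁻¹' {b} ∩ f ⁻¹' {a} ∩ h ⁻¹' {c})) := by
    simp only [entropy_prodMk g fun x => (f x, h x), Fintype.sum_prod_type, inter_assoc,
      ← singleton_prod_singleton, mk_preimage_prod]
  have hfibre : ∀ b,
      (∑ a, ∑ c, negMulLog (μ.real (g ⁻¹' {b} ∩ f ⁻¹' {a} ∩ h ⁻¹' {c}))) +
        negMulLog (μ.real (g ⁻¹' {b})) ≤
      (∑ a, negMulLog (μ.real (g ⁻¹' {b} ∩ f ⁻¹' {a}))) +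
        ∑ c, negMulLog (μ.real (g ⁻¹' {b} ∩ h ⁻¹' {c})) := by
    intro b
    have := sum_negMulLog_add_negMulLog_sum_le
      (q := fun a c => μ.real (g ⁻¹' {b} ∩ f ⁻¹' {a} ∩ h ⁻¹' {c})) fun _ _ => measureReal_nonneg
    have hcol : ∀ c, ∑ a, μ.real (g ⁻¹' {b} ∩ f ⁻¹' {a} ∩ h ⁻¹' {c}) =
        μ.real (g ⁻¹' {b} ∩ h ⁻¹' {c}) := fun c => by
      simp only [inter_right_comm _ (f ⁻¹' _), sum_measureReal_inter_preimage_singleton hf]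
    simpa only [hcol, sum_measureReal_inter_preimage_singleton hh,
      sum_measureReal_inter_preimage_singleton hf] using this
  have hsum := Finset.sum_le_sum fun b (_ : b ∈ Finset.univ) => hfibre b
  simp only [Finset.sum_add_distrib] at hsum
  simp only [condEntropy, htriple, entropy_prodMk g]
  simp only [entropy]
  linarith

lemma condEntropy_comp_le {f : X → ι} {g : X → κ} (hf : Measurable f) (hg : Measurable g)
    {ν : Type*} [Fintype ν] (k : ι → ν) : condEntropy μ (k ∘ f) g ≤ condEntropy μ f g :=
  sub_le_sub_right (entropy_comp_le (hg.prodMk hf) (Prod.map id k)) _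

lemma condEntropy_comp_self_le {g : X → κ} (hg : Measurable g) {ν : Type*} [Fintype ν]
    (k : κ → ν) : condEntropy μ (k ∘ g) g ≤ 0 :=
  sub_nonpos.2 (entropy_comp_le hg fun a => (a, k a))

lemma condEntropy_le_condEntropy_comp {f : X → ι} {g : X → κ} (hf : Measurable f)
    (hg : Measurable g) {ν : Type*} [Fintype ν] (k : κ → ν) :
    condEntropy μ f g ≤ condEntropy μ f (k ∘ g) := by
  let _ : MeasurableSpace ν := ⊤
  have hprod := condEntropy_prodMk_le (μ := μ) hg hf (k ∘ g)
  have htriple : entropy μ (fun x => (g x, f x)) ≤ entropy μ (fun x => ((k ∘ g) x, g x, f x)) :=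
    entropy_comp_le (((measurable_of_finite k).comp hg).prodMk (hg.prodMk hf)) Prod.snd
  have hpair : entropy μ (fun x => ((k ∘ g) x, g x)) ≤ entropy μ g :=
    entropy_comp_le hg fun a => (k a, a)
  simp only [condEntropy] at hprod ⊢
  linarith

lemma entropy_le_add_condEntropy {f : X → ι} {g : X → κ} (hf : Measurable f)
    (hg : Measurable g) : entropy μ f ≤ entropy μ g + condEntropy μ f g :=
  (entropy_comp_le (hg.prodMk hf) Prod.snd).trans_eq (add_sub_cancel _ _).symm

/-- The fibres of a function, as points of the pseudometric space of measurable sets with distance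
`μ (B ∆ D)`. -/
def fiber (μ : Measure X) {f : X → ι} (hf : Measurable f) (i : ι) : MeasuredSets μ :=
  ⟨f ⁻¹' {i}, hf (measurableSet_singleton i)⟩

lemma dist_measureReal_inter_le {s : Set X} (hs : MeasurableSet s) (B D : MeasuredSets μ) :
    dist (μ.real (s ∩ B)) (μ.real (s ∩ D)) ≤ dist B D :=
  calc dist (μ.real (s ∩ B)) (μ.real (s ∩ D)) ≤ μ.real ((s ∩ B) ∆ (s ∩ D)) :=
        abs_measureReal_sub_le_measureReal_symmDiff (hs.inter B.2).nullMeasurableSet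
          (hs.inter D.2).nullMeasurableSet
    _ = μ.real (s ∩ (B ∆ D : Set X)) := by rw [inter_symmDiff_distrib_left]
    _ ≤ dist B D := measureReal_mono inter_subset_right

lemma exists_forall_dist_fiber_lt_condEntropy_le {δ : ℝ} (hδ : 0 < δ) :
    ∃ ε > 0, ∀ {f g : X → ι} (hf : Measurable f) (hg : Measurable g),
      dist (fiber μ hf) (fiber μ hg) < ε → condEntropy μ f g ≤ δ := by
  have huc : UniformContinuousOn negMulLog (Icc 0 (μ.real univ)) :=
    isCompact_Icc.uniformContinuousOn_of_continuous continuous_negMulLog.continuousOn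
  obtain ⟨δ', hδ', hcard⟩ : ∃ δ' > 0, Fintype.card ι * (Fintype.card ι * δ') < δ := by
    simpa only [mul_assoc] using exists_pos_mul_lt hδ (Fintype.card ι * Fintype.card ι : ℝ)
  obtain ⟨ε, hε, hclose⟩ := Metric.uniformContinuousOn_iff.1 huc δ' hδ'
  refine ⟨ε, hε, fun {f g} hf hg hfg => ?_⟩
  have hcell : ∀ i j, negMulLog (μ.real (g ⁻¹' {i} ∩ f ⁻¹' {j})) ≤
      negMulLog (μ.real (g ⁻¹' {i} ∩ g ⁻¹' {j})) + δ' := by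
    intro i j
    have hdist := hclose _ ⟨measureReal_nonneg, measureReal_mono (subset_univ _)⟩ _
      ⟨measureReal_nonneg, measureReal_mono (subset_univ _)⟩
      ((dist_measureReal_inter_le (hg (measurableSet_singleton i))
        (fiber μ hf j) (fiber μ hg j)).trans_lt ((dist_le_pi_dist _ _ j).trans_lt hfg))
    exact sub_le_iff_le_add'.1 ((le_abs_self _).trans hdist.le)
  have hself : condEntropy μ g g ≤ 0 := condEntropy_comp_self_le hg id
  have hpair : entropy μ (fun x => (g x, f x)) ≤
      entropy μ (fun x => (g x, g x)) + Fintype.card ι * (Fintype.card ι * δ') := by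
    refine (entropy_prodMk g f).trans_le ((Finset.sum_le_sum fun i _ =>
      Finset.sum_le_sum fun j _ => hcell i j).trans_eq ?_)
    simp [entropy_prodMk, Finset.sum_add_distrib]
  simp only [condEntropy] at hself ⊢
  linarith

/-- Predict `g = 0` on the fibres of `f` where it is the likelier value: each fibre then
contributes the smaller of its two masses to the error, and at least as much to the entropy. -/
lemma exists_measureReal_symmDiff_le_condEntropy {ι : Type*} [Fintype ι] (f : X → ι)
    {g : X → Fin 2} (hg : Measurable g) :
    ∃ M : Set ι, μ.real ((g ⁻¹' {0}) ∆ (f ⁻¹' M)) ≤ condEntropy μ g f := by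
  classical
  let p : ι → Fin 2 → ℝ := fun i j => μ.real (f ⁻¹' {i} ∩ g ⁻¹' {j})
  refine ⟨{i | p i 1 ≤ p i 0}, ?_⟩
  have hsub : (g ⁻¹' {0}) ∆ (f ⁻¹' {i | p i 1 ≤ p i 0}) ⊆
      ⋃ i ∈ Finset.univ, f ⁻¹' {i} ∩ g ⁻¹' {if p i 1 ≤ p i 0 then 1 else 0} := by
    intro x hx
    simp only [Finset.mem_univ, iUnion_true, mem_iUnion]
    refine ⟨f x, rfl, ?_⟩
    rcases hx with ⟨hg0, hM⟩ | ⟨hM, hg0⟩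
    · rw [mem_preimage, mem_ofPred_eq] at hM
      rwa [if_neg hM]
    · rw [mem_preimage, mem_ofPred_eq] at hM
      rw [if_pos hM]
      exact Fin.eq_one_of_ne_zero _ hg0
  have herror : μ.real ((g ⁻¹' {0}) ∆ (f ⁻¹' {i | p i 1 ≤ p i 0})) ≤
      ∑ i, min (p i 0) (p i 1) := by
    refine (measureReal_mono hsub (measure_ne_top _ _)).trans
      ((measureReal_biUnion_finset_le _ _).trans (Finset.sum_le_sum fun i _ => ?_))
    split_ifs with h
    exacts [(min_eq_right h).ge, (min_eq_left (not_le.1 h).le).ge]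
  rw [condEntropy, entropy_prodMk, entropy, ← Finset.sum_sub_distrib]
  refine herror.trans (Finset.sum_le_sum fun i _ => le_sub_iff_add_le'.2 ?_)
  rw [← sum_measureReal_inter_preimage_singleton hg (f ⁻¹' {i}), Fin.sum_univ_two,
    Fin.sum_univ_two]
  exact negMulLog_add_add_min_le measureReal_nonneg measureReal_nonneg

end Entropy

section EntropyRate

variable {X ι κ : Type*} [Fintype ι] [Fintype κ]

/-- The join of the first `n` labellings of a sequence. -/
def join {ι : Type*} (g : ℕ → X → ι) (n : ℕ) (x : X) : Fin n → ι :=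
  fun i => g i x

variable [MeasurableSpace X] {μ : Measure X}

lemma measurable_join {ι : Type*} [MeasurableSpace ι] {g : ℕ → X → ι}
    (hg : ∀ i, Measurable (g i)) (n : ℕ) : Measurable (join g n) :=
  measurable_pi_lambda _ fun i => hg i

/-- The growth rate of the entropy of the joins of a sequence of labellings. -/
def entropyRate (μ : Measure X) (g : ℕ → X → ι) : EReal :=
  limsup (fun n : ℕ => ((1 / (n : ℝ) * entropy μ (join g n) : ℝ) : EReal)) atTop

lemma entropyRate_nonneg [IsProbabilityMeasure μ] (g : ℕ → X → ι) : 0 ≤ entropyRate μ g :=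
  le_limsup_of_frequently_le <| .of_forall fun _ =>
    EReal.coe_nonneg.2 (mul_nonneg (by positivity) (entropy_nonneg _))

lemma entropyRate_le_of_forall_entropy_join_le {g : ℕ → X → ι} {C δ : ℝ}
    (h : ∀ n : ℕ, entropy μ (join g n) ≤ C + n * δ) : entropyRate μ g ≤ δ := by
  have hlim : Tendsto (fun n : ℕ => ((1 / (n : ℝ) * C + δ : ℝ) : EReal)) atTop (𝓝 (δ : EReal)) := by
    refine (continuous_coe_real_ereal.tendsto δ).comp ?_
    simpa only [zero_mul, zero_add] using
      (tendsto_one_div_atTop_nhds_zero_nat.mul_const C).add_const δ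
  refine (limsup_le_limsup ?_).trans_eq hlim.limsup_eq
  filter_upwards [eventually_gt_atTop 0] with n hn
  have hn' : (n : ℝ) ≠ 0 := Nat.cast_ne_zero.2 hn.ne'
  calc ((1 / (n : ℝ) * entropy μ (join g n) : ℝ) : EReal)
      ≤ (1 / (n : ℝ) * (C + n * δ) : ℝ) := by
        gcongr
        exact h n
    _ = (1 / (n : ℝ) * C + δ : ℝ) := by
        rw [mul_add, one_div, inv_mul_cancel_left₀ hn']

lemma le_entropyRate_of_forall_le_entropy_join {g : ℕ → X → ι} {δ : ℝ}
    (h : ∀ n : ℕ, n * δ ≤ entropy μ (join g n)) : δ ≤ entropyRate μ g := by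
  refine le_limsup_of_frequently_le (Eventually.frequently ?_)
  filter_upwards [eventually_gt_atTop 0] with n hn
  have hn' : (0 : ℝ) < n := Nat.cast_pos.2 hn
  rw [EReal.coe_le_coe_iff, one_div, le_inv_mul_iff₀ hn']
  exact h n

variable [IsFiniteMeasure μ] [MeasurableSpace ι] [MeasurableSingletonClass ι] [MeasurableSpace κ]
  [MeasurableSingletonClass κ]

lemma entropy_join_add_condEntropy_le {g : ℕ → X → ι} (hg : ∀ i, Measurable (g i)) (n : ℕ) :
    entropy μ (join g n) + condEntropy μ (g n) (join g n) ≤ entropy μ (join g (n + 1)) :=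
  (add_sub_cancel _ _).trans_le <| entropy_comp_le (measurable_join hg (n + 1))
    fun a => (fun i : Fin n => a i.castSucc, a (Fin.last n))

lemma condEntropy_join_le {η : X → κ} (hη : Measurable η) {g : ℕ → X → ι}
    (hg : ∀ i, Measurable (g i)) {δ : ℝ} (h : ∀ i, condEntropy μ (g i) η ≤ δ) (n : ℕ) :
    condEntropy μ (join g n) η ≤ n * δ := by
  induction n with
  | zero =>
    have hconst : join g 0 = (fun _ i => i.elim0) ∘ η := by
      funext x i
      exact i.elim0
    simpa only [hconst, Nat.cast_zero, zero_mul] using condEntropy_comp_self_le hη _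
  | succ n ih =>
    have hsnoc : join g (n + 1) =
        (fun a : (Fin n → ι) × ι => (Fin.snoc a.1 a.2 : Fin (n + 1) → ι)) ∘
          fun x => (join g n x, g n x) := by
      funext x i
      refine Fin.lastCases ?_ (fun j => ?_) i <;> simp [join]
    calc condEntropy μ (join g (n + 1)) η
        ≤ condEntropy μ (fun x => (join g n x, g n x)) η := by
          rw [hsnoc]
          exact condEntropy_comp_le ((measurable_join hg n).prodMk (hg n)) hη _
      _ ≤ condEntropy μ (join g n) η + condEntropy μ (g n) η :=
          condEntropy_prodMk_le (measurable_join hg n) (hg n) η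
      _ ≤ (n + 1 : ℕ) * δ := by
          push_cast
          linarith [h n]

end EntropyRate

section TotallyBounded

variable {β E : Type*} [PseudoMetricSpace E] {v : β → E}

lemma exists_finset_dist_lt_of_totallyBounded_range (hv : TotallyBounded (range v)) {ε : ℝ}
    (hε : 0 < ε) : ∃ F : Finset β, ∀ b, ∃ m ∈ F, dist (v b) (v m) < ε := by
  classical
  obtain ⟨t, htv, htf, ht⟩ := Metric.finite_approx_of_totallyBounded hv ε hε
  lift t to Finset E using htf
  obtain ⟨F, -, rfl⟩ := Finset.subset_set_image_iff.1 (htv.trans_eq image_univ.symm)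
  refine ⟨F, fun b => ?_⟩
  simpa using ht (mem_range_self b)

variable {X ι : Type*} [MeasurableSpace X] {μ : Measure X} [Fintype ι]
  [MeasurableSpace ι] [MeasurableSingletonClass ι]

lemma entropyRate_nonpos_of_totallyBounded [IsFiniteMeasure μ] {g : β → X → ι}
    (hg : ∀ b, Measurable (g b)) (htb : TotallyBounded (range fun b => fiber μ (hg b)))
    (φ : ℕ → β) : entropyRate μ (g ∘ φ) ≤ 0 := by
  classical
  refine EReal.le_of_forall_lt_iff_le.1 fun δ hδ => ?_
  obtain ⟨ε, hε, hclose⟩ :=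
    exists_forall_dist_fiber_lt_condEntropy_le (μ := μ) (ι := ι) (EReal.coe_pos.1 hδ)
  obtain ⟨F, hF⟩ := exists_finset_dist_lt_of_totallyBounded_range htb hε
  let η : X → F → ι := fun x m => g m x
  have hη : Measurable η := measurable_pi_lambda _ fun m => hg m
  have hcond : ∀ n, condEntropy μ ((g ∘ φ) n) η ≤ δ := by
    intro n
    obtain ⟨m, hm, hdist⟩ := hF (φ n)
    exact (condEntropy_le_condEntropy_comp (hg _) hη fun a => a ⟨m, hm⟩).trans
      (hclose (hg _) (hg m) hdist)
  refine entropyRate_le_of_forall_entropy_join_le (C := entropy μ η) fun n => ?_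
  exact (entropy_le_add_condEntropy (measurable_join (fun i => hg (φ i)) n) hη).trans
    (add_le_add_right (condEntropy_join_le hη (fun i => hg (φ i)) hcond n) _)

lemma exists_pos_forall_exists_le_condEntropy [IsFiniteMeasure μ] {g : ℕ → X → Fin 2}
    (hg : ∀ n, Measurable (g n)) (htb : ¬ TotallyBounded (range fun n => fiber μ (hg n) 0)) :
    ∃ ε > 0, ∀ N, ∃ n ≥ N, ε ≤ condEntropy μ (g n) (join g N) := by
  simp only [Metric.totallyBounded_iff, not_forall, not_exists, not_and, range_subset_iff] at htb
  obtain ⟨ε, hε, hfar⟩ := htb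
  refine ⟨ε, hε, fun N => ?_⟩
  let B : Set (Fin N → Fin 2) → MeasuredSets μ := fun M =>
    ⟨join g N ⁻¹' M, measurable_join hg N .of_discrete⟩
  obtain ⟨n, hn⟩ := hfar (range B) (finite_range B)
  simp only [mem_iUnion, mem_range, exists_prop, exists_exists_eq_and, not_exists,
    Metric.mem_ball, not_lt] at hn
  have hle : ε ≤ condEntropy μ (g n) (join g N) := by
    obtain ⟨M, hM⟩ := exists_measureReal_symmDiff_le_condEntropy (μ := μ) (join g N) (hg n)
    exact (hn M).trans hM
  refine ⟨n, ?_, hle⟩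
  by_contra! hnN
  exact (hε.trans_le hle).not_ge
    (condEntropy_comp_self_le (measurable_join hg N) fun a => a ⟨n, hnN⟩)

lemma exists_strictMono_entropyRate_pos [IsProbabilityMeasure μ] {g : ℕ → X → Fin 2}
    (hg : ∀ n, Measurable (g n)) (htb : ¬ TotallyBounded (range fun n => fiber μ (hg n) 0)) :
    ∃ φ : ℕ → ℕ, StrictMono φ ∧ 0 < entropyRate μ (g ∘ φ) := by
  obtain ⟨ε, hε, hfar⟩ := exists_pos_forall_exists_le_condEntropy hg htb
  choose next hle hnext using hfar
  let bound : ℕ → ℕ := fun n => (fun N => next N + 1)^[n] 0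
  let φ : ℕ → ℕ := fun n => next (bound n)
  have hbound : ∀ n, bound (n + 1) = φ n + 1 := fun n => Function.iterate_succ_apply' _ _ _
  have hbound_mono : Monotone bound := monotone_nat_of_le_succ fun n =>
    (hle (bound n)).trans (by rw [hbound]; exact Nat.le_succ _)
  have hφ : StrictMono φ := strictMono_nat_of_lt_succ fun n =>
    (Nat.lt_succ_self _).trans_le ((hbound n).symm.trans_le (hle _))
  have hφ_lt : ∀ {i n}, i < n → φ i < bound n := fun {i n} hin =>
    Nat.lt_of_succ_le ((hbound i).symm.trans_le (hbound_mono hin))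
  have hstep : ∀ n, ε ≤ condEntropy μ (g (φ n)) (join (g ∘ φ) n) := fun n =>
    (hnext (bound n)).trans (condEntropy_le_condEntropy_comp (hg _) (measurable_join hg _)
      fun a (i : Fin n) => a ⟨φ i, hφ_lt i.2⟩)
  refine ⟨φ, hφ, (EReal.coe_pos.2 hε).trans_le
    (le_entropyRate_of_forall_le_entropy_join fun n => ?_)⟩
  induction n with
  | zero => simpa using entropy_nonneg (join (g ∘ φ) 0)
  | succ n ih =>
    calc ((n + 1 : ℕ) : ℝ) * ε = n * ε + ε := by push_cast; ring
      _ ≤ entropy μ (join (g ∘ φ) n) + condEntropy μ (g (φ n)) (join (g ∘ φ) n) :=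
        add_le_add ih (hstep n)
      _ ≤ entropy μ (join (g ∘ φ) (n + 1)) :=
        entropy_join_add_condEntropy_le (fun i => hg (φ i)) n

end TotallyBounded

section Partitions

variable {X ι : Type*} [MeasurableSpace X]

lemma MeasPartition.exists_mem_cell (ξ : MeasPartition X ι) (x : X) : ∃ i, x ∈ ξ.cell i :=
  mem_iUnion.1 (ξ.iUnion_cell ▸ mem_univ x)

/-- The function sending a point to the label of the cell of `ξ` containing it. -/
def MeasPartition.label (ξ : MeasPartition X ι) (x : X) : ι :=
  (ξ.exists_mem_cell x).choose

lemma MeasPartition.label_eq_iff (ξ : MeasPartition X ι) {x : X} {i : ι} :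
    ξ.label x = i ↔ x ∈ ξ.cell i := by
  have hx : x ∈ ξ.cell (ξ.label x) := (ξ.exists_mem_cell x).choose_spec
  refine ⟨fun h => h ▸ hx, fun hi => ?_⟩
  by_contra hne
  exact disjoint_left.1 (ξ.disjoint_cell hne) hx hi

lemma MeasPartition.preimage_label (ξ : MeasPartition X ι) (i : ι) :
    ξ.label ⁻¹' {i} = ξ.cell i :=
  Set.ext fun _ => ξ.label_eq_iff

lemma MeasPartition.measurable_label [Countable ι] [MeasurableSpace ι] (ξ : MeasPartition X ι) :
    Measurable ξ.label :=
  measurable_to_countable' fun i => ξ.preimage_label i ▸ ξ.measurableSet_cell i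

/-- The partition of `X` into the fibres of a measurable function. -/
def MeasPartition.ofLabel [MeasurableSpace ι] [MeasurableSingletonClass ι] {f : X → ι}
    (hf : Measurable f) : MeasPartition X ι where
  cell i := f ⁻¹' {i}
  measurableSet_cell i := hf (measurableSet_singleton i)
  disjoint_cell _ _ hij := (disjoint_singleton.2 hij).preimage f
  iUnion_cell := by rw [← preimage_iUnion, iUnion_of_singleton, preimage_univ]

lemma MeasPartition.label_ofLabel [MeasurableSpace ι] [MeasurableSingletonClass ι] {f : X → ι}
    (hf : Measurable f) : (ofLabel hf).label = f :=
  funext fun _ => (ofLabel hf).label_eq_iff.2 rfl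

variable {μ : Measure X} {T : X → X}

lemma seqEntropyPartition_eq_entropyRate [Fintype ι] (hT : Measurable T) (S : ℕ → ℕ)
    (ξ : MeasPartition X ι) :
    seqEntropyPartition μ hT S ξ = entropyRate μ fun n => ξ.label ∘ T^[S n] := by
  have hcell : ∀ (n : ℕ) (a : Fin n → ι),
      (MeasPartition.join fun i : Fin n => ξ.pullback (T^[S i]) (hT.iterate (S i))).cell a =
        join (fun n => ξ.label ∘ T^[S n]) n ⁻¹' {a} := by
    intro n a
    ext x
    simp [MeasPartition.join, MeasPartition.pullback, join, funext_iff, ξ.label_eq_iff]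
  simp only [seqEntropyPartition, partitionEntropy, hcell, entropyRate, entropy, negMulLog,
    neg_mul, Finset.sum_neg_distrib]

lemma seqEntropy_eq_zero_iff [IsProbabilityMeasure μ] (hT : Measurable T) (S : ℕ → ℕ) :
    seqEntropy μ hT S = 0 ↔ ∀ (k : ℕ) (f : X → Fin k), Measurable f →
      entropyRate μ (fun n => f ∘ T^[S n]) ≤ 0 := by
  have hlabel : ∀ {k : ℕ} {f : X → Fin k}, Measurable f →
      entropyRate μ (fun n => f ∘ T^[S n]) ≤ seqEntropy μ hT S := by
    intro k f hf
    rw [← MeasPartition.label_ofLabel hf, ← seqEntropyPartition_eq_entropyRate hT]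
    exact le_iSup₂ (f := fun k (ξ : MeasPartition X (Fin k)) => seqEntropyPartition μ hT S ξ) k _
  refine ⟨fun h k f hf => (hlabel hf).trans_eq h, fun h => le_antisymm (iSup₂_le fun k ξ => ?_) ?_⟩
  · rw [seqEntropyPartition_eq_entropyRate]
    exact h k ξ.label ξ.measurable_label
  · exact (entropyRate_nonneg _).trans (hlabel (f := fun _ => (0 : Fin 1)) measurable_const)

end Partitions

section UniformSpaces

variable {β ι E F : Type*}

lemma totallyBounded_range_pi [UniformSpace E] {v : β → ι → E}
    (h : ∀ i, TotallyBounded (range fun b => v b i)) : TotallyBounded (range v) := by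
  refine totallyBounded_iff_ultrafilter.2 fun l hl => (cauchy_pi_iff' _).2 fun i => ?_
  refine totallyBounded_iff_ultrafilter.1 (h i) (l.map fun a => a i) ?_
  refine (map_mono hl).trans_eq ?_
  rw [map_principal, ← range_comp]
  rfl

lemma totallyBounded_range_add [UniformSpace E] [AddGroup E] [IsUniformAddGroup E] {v w : β → E}
    (hv : TotallyBounded (range v)) (hw : TotallyBounded (range w)) :
    TotallyBounded (range fun b => v b + w b) := by
  have hpair : TotallyBounded (range fun b => ![v b, w b]) :=
    totallyBounded_range_pi (Fin.forall_fin_two.2 ⟨hv, hw⟩)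
  have hadd : UniformContinuous fun p : Fin 2 → E => p 0 + p 1 :=
    (Pi.uniformContinuous_proj _ 0).add (Pi.uniformContinuous_proj _ 1)
  have himage := hpair.image hadd
  rwa [← range_comp] at himage

lemma isClosed_setOf_totallyBounded_range [TopologicalSpace E] [PseudoMetricSpace F]
    {U : β → E → F} (hU : Equicontinuous U) :
    IsClosed {f | TotallyBounded (range fun b => U b f)} := by
  refine isClosed_of_closure_subset fun f hf => Metric.totallyBounded_iff.2 fun ε hε => ?_
  have hnear := Metric.equicontinuousAt_iff_right.1 (hU f) (ε / 2) (half_pos hε)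
  obtain ⟨g, hg, hgf⟩ := ((mem_closure_iff_frequently.1 hf).and_eventually hnear).exists
  obtain ⟨t, ht, hcover⟩ := Metric.totallyBounded_iff.1 hg (ε / 2) (half_pos hε)
  refine ⟨t, ht, range_subset_iff.2 fun b => ?_⟩
  obtain ⟨y, hy, hdist⟩ := mem_iUnion₂.1 (hcover (mem_range_self b))
  exact mem_iUnion₂.2 ⟨y, hy, (dist_triangle _ _ _).trans_lt
    ((add_lt_add (hgf b) hdist).trans_eq (add_halves ε))⟩

lemma isometry_iterate [PseudoMetricSpace E] {U : E → E} (hU : Isometry U) :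
    ∀ n, Isometry U^[n]
  | 0 => isometry_id
  | n + 1 => (isometry_iterate hU n).comp hU

lemma equicontinuous_iterate_of_isometry [PseudoMetricSpace E] {U : E → E} (hU : Isometry U)
    (A : β → ℕ) : Equicontinuous fun b => U^[A b] :=
  (LipschitzWith.uniformEquicontinuous _ 1 fun b =>
    (isometry_iterate hU (A b)).lipschitz).equicontinuous

end UniformSpaces

section Koopman

variable {X : Type*} [MeasurableSpace X] {μ : Measure X} {T : X → X} {𝕜 : Type*} [RCLike 𝕜]

/-- `T⁻ⁿ B`, as a point of the pseudometric space of measurable sets. -/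
def iteratePreimage (hT : Measurable T) (n : ℕ) (B : MeasuredSets μ) : MeasuredSets μ :=
  ⟨T^[n] ⁻¹' B, hT.iterate n B.2⟩

lemma precompactAlong_iff_totallyBounded_range_koopman (hT : MeasurePreserving T μ μ) (A : ℕ → ℕ) :
    PrecompactAlong 𝕜 hT A ↔
      ∀ f : Lp 𝕜 2 μ, TotallyBounded (range fun n => (koopman 𝕜 hT)^[A n] f) := by
  refine forall_congr' fun f => ?_
  rw [← range_comp]
  exact ⟨fun h => h.totallyBounded.subset subset_closure,
    fun h => h.closure.isCompact_of_isClosed isClosed_closure⟩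

variable [IsFiniteMeasure μ]

variable (𝕜) in
/-- The indicator function of a measurable set, as an element of `L²(μ)`. -/
def indicatorLp (B : MeasuredSets μ) : Lp 𝕜 2 μ :=
  indicatorConstLp 2 B.2 (measure_ne_top μ B) 1

lemma indicatorConstLp_eq_smul_indicatorLp (B : MeasuredSets μ) (c : 𝕜) :
    indicatorConstLp 2 B.2 (measure_ne_top μ B) c = c • indicatorLp 𝕜 B := by
  rw [indicatorLp, indicatorConstLp, indicatorConstLp, ← MemLp.toLp_const_smul]
  congr 1
  ext x
  simp [Set.indicator]

lemma dist_indicatorLp (B D : MeasuredSets μ) :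
    dist (indicatorLp 𝕜 B) (indicatorLp 𝕜 D) = √(dist B D) := by
  rw [indicatorLp, indicatorLp, dist_indicatorConstLp_eq_norm,
    norm_indicatorConstLp two_ne_zero ENNReal.ofNat_ne_top, norm_one, one_mul,
    ENNReal.toReal_ofNat, ← Real.sqrt_eq_rpow]
  rfl

lemma isUniformInducing_indicatorLp :
    IsUniformInducing (indicatorLp 𝕜 : MeasuredSets μ → Lp 𝕜 2 μ) := by
  refine Metric.isUniformInducing_iff.2 ⟨Metric.uniformContinuous_iff.2 fun ε hε => ?_,
    fun δ hδ => ?_⟩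
  · exact ⟨ε ^ 2, by positivity, fun _ _ h => by
      rwa [dist_indicatorLp, Real.sqrt_lt' hε]⟩
  · exact ⟨√δ, Real.sqrt_pos.2 hδ, fun h => by
      rwa [dist_indicatorLp, Real.sqrt_lt_sqrt_iff dist_nonneg] at h⟩

lemma koopman_iterate_indicatorLp (hT : MeasurePreserving T μ μ) (n : ℕ) (B : MeasuredSets μ) :
    (koopman 𝕜 hT)^[n] (indicatorLp 𝕜 B) =
      indicatorLp 𝕜 (iteratePreimage hT.measurable n B) := by
  change (Lp.compMeasurePreserving T hT)^[n] _ = _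
  rw [Lp.compMeasurePreserving_iterate]
  exact Lp.indicatorConstLp_compMeasurePreserving ..

lemma precompactAlong_iff_totallyBounded_range_iteratePreimage (hT : MeasurePreserving T μ μ)
    (A : ℕ → ℕ) :
    PrecompactAlong 𝕜 hT A ↔ ∀ B : MeasuredSets μ,
      TotallyBounded (range fun n => iteratePreimage hT.measurable (A n) B) := by
  have hindicator : ∀ B : MeasuredSets μ,
      TotallyBounded (range fun n => (koopman 𝕜 hT)^[A n] (indicatorLp 𝕜 B)) ↔
        TotallyBounded (range fun n => iteratePreimage hT.measurable (A n) B) := by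
    intro B
    simp only [koopman_iterate_indicatorLp]
    rw [← totallyBounded_image_iff (isUniformInducing_indicatorLp (𝕜 := 𝕜)), ← range_comp]
    rfl
  rw [precompactAlong_iff_totallyBounded_range_koopman]
  refine ⟨fun h B => (hindicator B).1 (h _), fun h f => ?_⟩
  induction f using Lp.induction (p := 2) ENNReal.ofNat_ne_top with
  | @indicatorConst c s hs _ =>
    rw [Lp.simpleFunc.coe_indicatorConst, indicatorConstLp_eq_smul_indicatorLp ⟨s, hs⟩ c]
    have hsmul := ((hindicator ⟨s, hs⟩).2 (h _)).image (uniformContinuous_const_smul c)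
    rw [← range_comp] at hsmul
    convert hsmul with n
    exact Function.Commute.iterate_left (fun f => (koopman 𝕜 hT).map_smul c f) (A n) _
  | add _ _ _ ihf ihg =>
    simpa only [iterate_map_add] using totallyBounded_range_add ihf ihg
  | isClosed =>
    exact isClosed_setOf_totallyBounded_range
      (equicontinuous_iterate_of_isometry (koopman 𝕜 hT).isometry A)

end Koopman

section Equivalence

variable {X : Type*} [MeasurableSpace X] {μ : Measure X} [IsProbabilityMeasure μ] {T : X → X}
  {A : ℕ → ℕ}

lemma zeroEntropyAlong_iff_totallyBounded_range_iteratePreimage (hT : MeasurePreserving T μ μ) :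
    ZeroEntropyAlong hT A ↔ ∀ B : MeasuredSets μ,
      TotallyBounded (range fun n => iteratePreimage hT.measurable (A n) B) := by
  simp only [ZeroEntropyAlong, seqEntropy_eq_zero_iff]
  refine ⟨fun h B => ?_, fun h φ _ k f hf => ?_⟩
  · classical
    by_contra hB
    let f : X → Fin 2 := fun x => if x ∈ (B : Set X) then 0 else 1
    have hf : Measurable f := measurable_const.ite B.2 measurable_const
    have hfiber : ∀ n, fiber μ (hf.comp (hT.measurable.iterate (A n))) 0 =
        iteratePreimage hT.measurable (A n) B := by
      intro n
      refine Subtype.ext (Set.ext fun x => ?_)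
      simp [fiber, iteratePreimage, f]
    simp only [← hfiber] at hB
    obtain ⟨φ, hφ, hpos⟩ := exists_strictMono_entropyRate_pos _ hB
    exact hpos.not_ge (h φ hφ 2 f hf)
  · exact entropyRate_nonpos_of_totallyBounded (fun n => hf.comp (hT.measurable.iterate (A n)))
      (totallyBounded_range_pi fun i => h (fiber μ hf i)) φ

theorem zeroEntropyAlong_iff_precompactAlong {𝕜 : Type*} [RCLike 𝕜]
    (hT : MeasurePreserving T μ μ) : ZeroEntropyAlong hT A ↔ PrecompactAlong 𝕜 hT A :=
  (zeroEntropyAlong_iff_totallyBounded_range_iteratePreimage hT).trans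
    (precompactAlong_iff_totallyBounded_range_iteratePreimage hT A).symm

end Equivalence

section Recurrence

variable {E : Type*} [PseudoMetricSpace E] {U : E → E} {A : ℕ → ℕ}

lemma frequently_dist_iterate_lt (hU : Isometry U) (hA : Tendsto A atTop atTop) {f : E}
    (hf : TotallyBounded (range fun n => U^[A n] f)) {ε : ℝ} (hε : 0 < ε) :
    ∃ᶠ t in atTop, dist (U^[t] f) f < ε := by
  obtain ⟨F, hF⟩ := exists_finset_dist_lt_of_totallyBounded_range hf hε
  refine frequently_atTop.2 fun N => ?_
  obtain ⟨n, hn⟩ := ((Finset.eventually_all F).2 fun m _ =>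
    hA.eventually_ge_atTop (N + A m)).exists
  obtain ⟨m, hm, hdist⟩ := hF n
  have hNm : N + A m ≤ A n := hn m hm
  refine ⟨A n - A m, by lia, ?_⟩
  rwa [← (isometry_iterate hU (A m)).dist_eq, ← Function.iterate_add_apply,
    Nat.add_sub_cancel' (by lia)]

lemma exists_strictMono_tendsto_iterate [SeparableSpace E] (hU : Isometry U)
    (hA : Tendsto A atTop atTop) (h : ∀ f, TotallyBounded (range fun n => U^[A n] f)) :
    ∃ t : ℕ → ℕ, StrictMono t ∧ ∀ f, Tendsto (fun k => U^[t k] f) atTop (𝓝 f) := by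
  cases isEmpty_or_nonempty E
  · exact ⟨id, strictMono_id, isEmptyElim⟩
  -- Recurrence of the product isometry on `Fin k → E` returns `k` points simultaneously.
  have hfreq : ∀ k : ℕ, ∃ᶠ t in atTop,
      ∀ i : Fin k, dist (U^[t] (denseSeq E i)) (denseSeq E i) < 1 / (k + 1) := by
    intro k
    have hpi : TotallyBounded
        (range fun n => (Pi.map fun _ : Fin k => U)^[A n] fun i => denseSeq E i) := by
      simp only [Pi.map_iterate]
      exact totallyBounded_range_pi fun i => h (denseSeq E i)
    refine (frequently_dist_iterate_lt (Isometry.piMap _ fun _ => hU) hA hpi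
      (Nat.one_div_pos_of_nat (n := k))).mono fun t ht i => ?_
    rw [Pi.map_iterate] at ht
    exact (dist_le_pi_dist _ _ i).trans_lt ht
  obtain ⟨t, ht, hdist⟩ := extraction_forall_of_frequently hfreq
  have hclosed : IsClosed {f | Tendsto (fun k => U^[t k] f) atTop (𝓝 f)} :=
    (equicontinuous_iterate_of_isometry hU t).isClosed_setOfPred_tendsto continuous_id
  refine ⟨t, ht, fun f => hclosed.closure_subset_iff.2 (range_subset_iff.2 fun i => ?_)
    (denseRange_denseSeq E f)⟩
  refine tendsto_iff_dist_tendsto_zero.2 (squeeze_zero' (.of_forall fun _ => dist_nonneg) ?_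
    tendsto_one_div_add_atTop_nhds_zero_nat)
  filter_upwards [eventually_gt_atTop i] with k hk
  exact (hdist k ⟨i, hk⟩).le

end Recurrence

theorem isRigid_iff_exists_precompactAlong {𝕜 X : Type*} [RCLike 𝕜] [MeasurableSpace X]
    {μ : Measure X} [IsSeparable μ] {T : X → X} (hT : MeasurePreserving T μ μ) :
    IsRigid 𝕜 hT ↔ ∃ A : ℕ → ℕ, StrictMono A ∧ PrecompactAlong 𝕜 hT A := by
  simp only [precompactAlong_iff_totallyBounded_range_koopman]
  constructor
  · rintro ⟨t, ht, hlim⟩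
    exact ⟨t, ht, fun f => (hlim f).cauchySeq.totallyBounded_range⟩
  · rintro ⟨A, hA, htb⟩
    have : Fact ((2 : ℝ≥0∞) ≠ ∞) := ⟨ENNReal.ofNat_ne_top⟩
    exact exists_strictMono_tendsto_iterate (koopman 𝕜 hT).isometry hA.tendsto_atTop htb

end

end SeqEntropy

theorem theorem3p3 (𝕜 : Type*) [RCLike 𝕜] {X : Type*} [MeasurableSpace X]
    (μ : Measure X) [IsProbabilityMeasure μ] [IsSeparable μ]
    (T : X → X) (hT : MeasurePreserving T μ μ) :
    (SeqEntropy.IsRigid 𝕜 hT ↔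
      ∃ A : ℕ → ℕ, StrictMono A ∧ SeqEntropy.ZeroEntropyAlong hT A) ∧
    (SeqEntropy.IsRigid 𝕜 hT ↔
      ∃ A : ℕ → ℕ, StrictMono A ∧ SeqEntropy.PrecompactAlong 𝕜 hT A) ∧
    (∀ A : ℕ → ℕ, StrictMono A →
      (SeqEntropy.ZeroEntropyAlong hT A ↔ SeqEntropy.PrecompactAlong 𝕜 hT A)) := by
  have hentropy (A : ℕ → ℕ) :
      SeqEntropy.ZeroEntropyAlong hT A ↔ SeqEntropy.PrecompactAlong 𝕜 hT A :=
    SeqEntropy.zeroEntropyAlong_iff_precompactAlong hT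
  have hrigid := SeqEntropy.isRigid_iff_exists_precompactAlong (𝕜 := 𝕜) hT
  exact ⟨by simpa only [hentropy] using hrigid, hrigid, fun A _ => hentropy A⟩
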